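/- **Theorem.** Let $\mathcal X\subset\mathbb R^d$ be compact, $\mathcal T\subset\mathbb R$ a bounded interval, $n$ the number of stations, located at $y_1,\dots,y_n\in\mathcal X$, and $m$ the number of demand types. Let $r>0$ be a reward, and let $\delta(x,y)=\hat\delta(\|x-y\|_2)$, where $\hat\delta:[0,\infty)\to\mathbb R$ is continuous and convex with $\hat\delta(0)=0$, and is differentiable on $(0,\infty)$ with $\hat\delta'>0$ there. Let $\ell_j:\mathcal T\to[0,\infty)$ ($j\in[m]$) be continuous and integrable temporal costs, $c_i:\mathcal T\to(0,\infty)$ ($i\in[n]$) integrable capacities, and $\mu_j:\mathcal X\to[0,\infty)$ ($j\in[m]$) integrable demand densities. For $q\in\mathbb R_+^{n\times m}$ let $$OT_{\mathrm{time}}(c,q)=\inf_\nu\Big\{\sum_{i,j}\int_{\mathcal T}\ell_j(t)\,\nu_{ij}(t)\,dt:\ \sum_{j}\nu_{ij}(t)\le c_i(t)\ \forall i,t,\ \ \int_{\mathcal T}\nu_{ij}(t)\,dt=q_{ij}\ \forall i,j\Big\},$$ $$OT_{\mathrm{space}}(q,\mu)=\inf_\theta\Big\{\sum_{i,j}\int_{\mathcal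 X}\delta(x,y_i)\,\theta_{ij}(x)\,dx:\ \sum_{i}\theta_{ij}(x)\le \mu_j(x)\ \forall j,x,\ \ \int_{\mathcal X}\theta_{ij}(x)\,dx=q_{ij}\ \forall i,j\Big\},$$ where $\nu_{ij}$ and $\theta_{ij}$ range over the nonnegative integrable functions on $\mathcal T$ and on $\mathcal X$, the pointwise constraints are understood almost everywhere, and both infima take values in $[0,\infty]$. Then the optimal value of the spatiotemporal barycenter problem $$\text{(STB)}\qquad \sup_{q\in\mathbb R_+^{n\times m}}\ \sum_{i,j} r\,q_{ij}-OT_{\mathrm{time}}(c,q)-OT_{\mathrm{space}}(q,\mu)\quad\text{s.t. }\ \sum_i q_{ij}\le\int_{\mathcal X}\mu_j(x)\,dx\ \ \forall j,\quad \sum_j q_{ij}\le\int_{\mathcal T}c_i(t)\,dt\ \ \forall i,$$ equals the optimal value of the finite-dimensional problem $$\text{(STB-D)}\qquad \inf_{\eta\in\mathbb R^{n\times m}}\ \sum_{i=1}^n\int_{\mathcal T}\Big(\max_{j\in[m]}\big[\eta_{ij}-\ell_j(t)\big]\Big)^+c_i(t)\,dt+\sum_{j=1}^m\int_{\mathcal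 X}\Big(\max_{i\in[n]}\big[r-\eta_{ij}-\delta(x,y_i)\big]\Big)^+\mu_j(x)\,dx ,$$ and (STB-D) is a convex optimization problem: all the integrals in its objective are finite for every $\eta$, and the objective is a convex function of $\eta$ on $\mathbb R^{n\times m}$. -/

import Mathlib

open MeasureTheory

noncomputable section

namespace Matching

variable {n m d : ℕ}

/-- The points of the spatial domain live in `ℝ^d` with the Euclidean norm. -/
abbrev Space (d : ℕ) : Type := EuclideanSpace ℝ (Fin d)

/-- Membership in `L¹₊(B)`: (almost everywhere) nonnegative, integrable functions on `B` for the
Lebesgue measure. -/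
def IsDensityOn {E : Type*} [MeasureSpace E] (B : Set E) (f : E → ℝ) : Prop :=
  IntegrableOn f B ∧ ∀ᵐ x ∂(volume.restrict B), 0 ≤ f x

/-- Spatial cost `δ(x, y) = δ̂(‖x - y‖₂)`. -/
def spatialCost (δhat : ℝ → ℝ) (x y : Space d) : ℝ := δhat ‖x - y‖

/-- Total mass `ϱ(j) = ∫_X μ_j` of the demand of type `j`. -/
def typeMass (X : Set (Space d)) (μ : Fin m → Space d → ℝ) (j : Fin m) : ℝ :=
  ∫ x in X, μ j x

/-- Feasible plans of the temporal problem: `ν i j t` is the rate at which station `i` serves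
type `j` at time `t`; capacity is respected and `q i j` is the total mass served. -/
def TimeFeasible (T : Set ℝ) (c : Fin n → ℝ → ℝ) (q : Fin n → Fin m → ℝ)
    (ν : Fin n → Fin m → ℝ → ℝ) : Prop :=
  (∀ i j, IsDensityOn T (ν i j)) ∧
  (∀ i, ∀ᵐ t ∂(volume.restrict T), ∑ j, ν i j t ≤ c i t) ∧
  (∀ i j, ∫ t in T, ν i j t = q i j)

/-- `OT_time(c, q)`, with values in `[0, ∞]` (the infimum over the empty set is `∞`). -/
def otTime (T : Set ℝ) (ℓ : Fin m → ℝ → ℝ) (c : Fin n → ℝ → ℝ)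
    (q : Fin n → Fin m → ℝ) : ENNReal :=
  ⨅ (ν : Fin n → Fin m → ℝ → ℝ) (_ : TimeFeasible T c q ν),
    ∑ i, ∑ j, ∫⁻ t in T, ENNReal.ofReal (ℓ j t * ν i j t)

/-- Feasible plans of the spatial problem: `θ i j x` is the density of type `j` demand at `x`
assigned to station `i`; demand is respected and `q i j` is the total mass assigned. -/
def SpaceFeasible (X : Set (Space d)) (μ : Fin m → Space d → ℝ) (q : Fin n → Fin m → ℝ)
    (θ : Fin n → Fin m → Space d → ℝ) : Prop :=
  (∀ i j, IsDensityOn X (θ i j)) ∧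
  (∀ j, ∀ᵐ x ∂(volume.restrict X), ∑ i, θ i j x ≤ μ j x) ∧
  (∀ i j, ∫ x in X, θ i j x = q i j)

/-- `OT_space(q, μ)`, with values in `[0, ∞]` (the infimum over the empty set is `∞`). -/
def otSpace (X : Set (Space d)) (δhat : ℝ → ℝ) (y : Fin n → Space d)
    (μ : Fin m → Space d → ℝ) (q : Fin n → Fin m → ℝ) : ENNReal :=
  ⨅ (θ : Fin n → Fin m → Space d → ℝ) (_ : SpaceFeasible X μ q θ),
    ∑ i, ∑ j, ∫⁻ x in X, ENNReal.ofReal (spatialCost δhat x (y i) * θ i j x)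

/-- Feasible intermediate measures `q` on `[n] × [m]` of the barycenter problem. -/
def StbFeasible (X : Set (Space d)) (T : Set ℝ) (c : Fin n → ℝ → ℝ)
    (μ : Fin m → Space d → ℝ) (q : Fin n → Fin m → ℝ) : Prop :=
  (∀ i j, 0 ≤ q i j) ∧
  (∀ j, ∑ i, q i j ≤ typeMass X μ j) ∧
  (∀ i, ∑ j, q i j ≤ ∫ t in T, c i t)

/-- Objective of the barycenter problem; it is `-∞` where a transport cost is infinite. -/
def stbObjective (X : Set (Space d)) (T : Set ℝ) (r : ℝ) (δhat : ℝ → ℝ) (y : Fin n → Space d)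
    (ℓ : Fin m → ℝ → ℝ) (c : Fin n → ℝ → ℝ) (μ : Fin m → Space d → ℝ)
    (q : Fin n → Fin m → ℝ) : EReal :=
  ((∑ i, ∑ j, r * q i j : ℝ) : EReal) - (otTime T ℓ c q : EReal)
    - (otSpace X δhat y μ q : EReal)

/-- Optimal value of the spatiotemporal barycenter problem (STB) with `m` demand types. -/
def stbValue (X : Set (Space d)) (T : Set ℝ) (r : ℝ) (δhat : ℝ → ℝ) (y : Fin n → Space d)
    (ℓ : Fin m → ℝ → ℝ) (c : Fin n → ℝ → ℝ) (μ : Fin m → Space d → ℝ) : EReal :=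
  ⨆ (q : Fin n → Fin m → ℝ) (_ : StbFeasible X T c μ q),
    stbObjective X T r δhat y ℓ c μ q

/-- `(max_j [η_{ij} - ℓ_j(t)])⁺ c_i(t)`. -/
def timeIntegrand (ℓ : Fin m → ℝ → ℝ) (c : Fin n → ℝ → ℝ) (η : Fin n → Fin m → ℝ)
    (i : Fin n) (t : ℝ) : ℝ :=
  max (⨆ j, (η i j - ℓ j t)) 0 * c i t

/-- `(max_i [r - η_{ij} - δ(x, y_i)])⁺ μ_j(x)`. -/
def spaceIntegrand (r : ℝ) (δhat : ℝ → ℝ) (y : Fin n → Space d) (μ : Fin m → Space d → ℝ)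
    (η : Fin n → Fin m → ℝ) (j : Fin m) (x : Space d) : ℝ :=
  max (⨆ i, (r - η i j - spatialCost δhat x (y i))) 0 * μ j x

/-- Objective of the finite-dimensional program (STB-D) in the variable `η ∈ ℝ^{n × m}`. -/
def stbDObjective (X : Set (Space d)) (T : Set ℝ) (r : ℝ) (δhat : ℝ → ℝ)
    (y : Fin n → Space d) (ℓ : Fin m → ℝ → ℝ) (c : Fin n → ℝ → ℝ) (μ : Fin m → Space d → ℝ)
    (η : Fin n → Fin m → ℝ) : ℝ :=
  (∑ i, (∫ t in T, timeIntegrand ℓ c η i t))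
    + (∑ j, (∫ x in X, spaceIntegrand r δhat y μ η j x))

end Matching

end

namespace Matching

/-! Price each pair `(i, j)` by `η i j` in the temporal stage and `r - η i j` in the spatial stage.
The problem then splits into one allocation problem per station and one per demand type, each
sharing a capacity among finitely many types. The best profit of such a problem is the integral of
`surplus`: `attainable_le_surplus` bounds it and `exists_attainable_eq_surplus` attains it. Weak
duality is this bound summed over both stages. For the converse, let the two stages choose their
masses `u`, `v` independently. The Lagrangian is affine in `η` and linear in the plans, and `[0,
r]^(n×m)` is compact, so minimax yields one pair of plans that beats a given level for every `η` in
the box. Minimising over the box turns the revenue into `r * min u v`, and scaling both plans down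
to the common mass `min u v` only lowers costs. No compactness of plans is needed. -/

/-- Pointwise value of the best allocation of the capacity `c` at prices `p` and costs `g`. -/
noncomputable def surplus {Ω κ : Type*} (g : κ → Ω → ℝ) (c : Ω → ℝ) (p : κ → ℝ) (ω : Ω) : ℝ :=
  max (⨆ k, (p k - g k ω)) 0 * c ω

/-- The pairs (masses, total cost) of plans that share the capacity `c` among the types `κ` at
finite cost. -/
def attainable {Ω κ : Type*} [MeasurableSpace Ω] [Fintype κ] (P : Measure Ω) (g : κ → Ω → ℝ)
    (c : Ω → ℝ) : Set ((κ → ℝ) × ℝ) :=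
  {z | ∃ ν : κ → Ω → ℝ, (∀ k, Integrable (ν k) P) ∧ (∀ k, ∀ᵐ ω ∂P, 0 ≤ ν k ω) ∧
    (∀ᵐ ω ∂P, ∑ k, ν k ω ≤ c ω) ∧ (∀ k, ∫ ω, ν k ω ∂P = z.1 k) ∧
    (∀ k, Integrable (fun ω => g k ω * ν k ω) P) ∧ ∑ k, ∫ ω, g k ω * ν k ω ∂P = z.2}

/-! ### Sharing one capacity among finitely many types -/

theorem max_iSup_le {κ : Type*} {a : κ → ℝ} {b : ℝ} (hb : 0 ≤ b) (h : ∀ k, a k ≤ b) :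
    max (⨆ k, a k) 0 ≤ b :=
  max_le (Real.iSup_le h hb) hb

section

variable {Ω κ : Type*} [Fintype κ]

theorem sub_le_max_iSup (a : κ → ℝ) (k : κ) : a k ≤ max (⨆ k, a k) 0 :=
  (le_ciSup (Set.finite_range a).bddAbove k).trans (le_max_left _ _)

theorem exists_eq_of_max_iSup_pos {a : κ → ℝ} (h : 0 < max (⨆ k, a k) 0) :
    ∃ k, max (⨆ k, a k) 0 = a k := by
  rcases isEmpty_or_nonempty κ with hκ | hκ
  -- With no types the real supremum is `0` by convention, contradicting positivity.
  · simp at h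
  · obtain ⟨k, hk⟩ := exists_eq_ciSup_of_finite (f := a)
    refine ⟨k, ?_⟩
    rw [hk]
    refine max_eq_left ?_
    by_contra! h0
    rw [max_eq_right h0.le] at h
    exact lt_irrefl _ h

theorem surplus_convex (g : κ → Ω → ℝ) (c : Ω → ℝ) {ω : Ω} (hc : 0 ≤ c ω) {p p' : κ → ℝ}
    {a b : ℝ} (ha : 0 ≤ a) (hb : 0 ≤ b) (hab : a + b = 1) :
    surplus g c (a • p + b • p') ω ≤ a * surplus g c p ω + b * surplus g c p' ω := by
  have key : max (⨆ k, ((a • p + b • p') k - g k ω)) 0 ≤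
      a * max (⨆ k, (p k - g k ω)) 0 + b * max (⨆ k, (p' k - g k ω)) 0 := by
    refine max_iSup_le (by positivity) fun k => ?_
    have h1 := mul_le_mul_of_nonneg_left (sub_le_max_iSup (fun k => p k - g k ω) k) ha
    have h2 := mul_le_mul_of_nonneg_left (sub_le_max_iSup (fun k => p' k - g k ω) k) hb
    have h3 : (a • p + b • p') k - g k ω = a * (p k - g k ω) + b * (p' k - g k ω) := by
      simp only [Pi.add_apply, Pi.smul_apply, smul_eq_mul]
      linear_combination (g k ω) * hab
    rw [h3]
    exact add_le_add h1 h2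
  have := mul_le_mul_of_nonneg_right key hc
  unfold surplus
  linarith

variable [MeasurableSpace Ω] {P : Measure Ω} {g : κ → Ω → ℝ} {c : Ω → ℝ}

theorem aemeasurable_max_iSup (hg : ∀ k, AEMeasurable (g k) P) (p : κ → ℝ) :
    AEMeasurable (fun ω => max (⨆ k, (p k - g k ω)) 0) P :=
  (AEMeasurable.iSup fun k => (hg k).const_sub (p k)).max aemeasurable_const

theorem integrable_surplus (hg : ∀ k, AEMeasurable (g k) P) (hg0 : ∀ k, ∀ᵐ ω ∂P, 0 ≤ g k ω)
    (hc : Integrable c P) (p : κ → ℝ) : Integrable (surplus g c p) P := by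
  -- Costs may be unbounded, but being nonnegative they leave the factor of `c` between `0` and `∑
  -- k, |p k|`.
  refine hc.bdd_mul (c := ∑ k, |p k|) (aemeasurable_max_iSup hg p).aestronglyMeasurable ?_
  filter_upwards [ae_all_iff.2 hg0] with ω h0
  have hs : 0 ≤ ∑ k, |p k| := Finset.sum_nonneg fun k _ => abs_nonneg _
  rw [Real.norm_of_nonneg (le_max_right _ _)]
  refine max_iSup_le hs fun k => ?_
  have := Finset.single_le_sum (f := fun k => |p k|) (fun k _ => abs_nonneg _) (Finset.mem_univ k)
  linarith [h0 k, le_abs_self (p k)]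

theorem convexOn_integral_surplus (hg : ∀ k, AEMeasurable (g k) P)
    (hg0 : ∀ k, ∀ᵐ ω ∂P, 0 ≤ g k ω) (hc : Integrable c P) (hc0 : ∀ᵐ ω ∂P, 0 ≤ c ω) :
    ConvexOn ℝ Set.univ fun p : κ → ℝ => ∫ ω, surplus g c p ω ∂P := by
  refine ⟨convex_univ, fun p _ p' _ a b ha hb hab => ?_⟩
  have hi := integrable_surplus hg hg0 hc
  simp only [smul_eq_mul]
  rw [← integral_const_mul, ← integral_const_mul,
    ← integral_add ((hi p).const_mul a) ((hi p').const_mul b)]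
  refine integral_mono_ae (hi _) (((hi p).const_mul a).add ((hi p').const_mul b)) ?_
  filter_upwards [hc0] with ω h
  exact surplus_convex g c h ha hb hab

theorem attainable_nonneg {z : (κ → ℝ) × ℝ} (hz : z ∈ attainable P g c) (k : κ) : 0 ≤ z.1 k := by
  obtain ⟨ν, -, h0, -, hm, -⟩ := hz
  rw [← hm k]
  exact integral_nonneg_of_ae (h0 k)

theorem attainable_sum_le (hc : Integrable c P) {z : (κ → ℝ) × ℝ} (hz : z ∈ attainable P g c) :
    ∑ k, z.1 k ≤ ∫ ω, c ω ∂P := by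
  obtain ⟨ν, hi, -, hle, hm, -⟩ := hz
  simp_rw [← hm]
  rw [← integral_finsetSum _ fun k _ => hi k]
  exact integral_mono_ae (integrable_finsetSum _ fun k _ => hi k) hc hle

/-- Each unit served earns at most the positive part of the best margin `p k - g k ω`, and at most
`c ω` units are served. -/
theorem attainable_le_surplus (hg : ∀ k, AEMeasurable (g k) P)
    (hg0 : ∀ k, ∀ᵐ ω ∂P, 0 ≤ g k ω) (hc : Integrable c P) {z : (κ → ℝ) × ℝ}
    (hz : z ∈ attainable P g c) (p : κ → ℝ) :
    ∑ k, p k * z.1 k - z.2 ≤ ∫ ω, surplus g c p ω ∂P := by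
  obtain ⟨ν, hi, h0, hle, hm, hgi, hs⟩ := hz
  have hterm : ∀ k, Integrable (fun ω => p k * ν k ω - g k ω * ν k ω) P :=
    fun k => ((hi k).const_mul (p k)).sub (hgi k)
  have : ∑ k, p k * z.1 k - z.2 = ∫ ω, ∑ k, (p k * ν k ω - g k ω * ν k ω) ∂P := by
    rw [integral_finsetSum _ fun k _ => hterm k, ← hs, ← Finset.sum_sub_distrib]
    refine Finset.sum_congr rfl fun k _ => ?_
    rw [integral_sub ((hi k).const_mul (p k)) (hgi k), integral_const_mul, hm]
  rw [this]
  refine integral_mono_ae (integrable_finsetSum _ fun k _ => hterm k)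
    (integrable_surplus hg hg0 hc p) ?_
  filter_upwards [ae_all_iff.2 h0, hle] with ω hν hsum
  calc ∑ k, (p k * ν k ω - g k ω * ν k ω)
      ≤ ∑ k, max (⨆ k, (p k - g k ω)) 0 * ν k ω := by
        refine Finset.sum_le_sum fun k _ => ?_
        rw [← sub_mul]
        exact mul_le_mul_of_nonneg_right (sub_le_max_iSup (fun k => p k - g k ω) k) (hν k)
    _ = max (⨆ k, (p k - g k ω)) 0 * ∑ k, ν k ω := by rw [Finset.mul_sum]
    _ ≤ surplus g c p ω := mul_le_mul_of_nonneg_left hsum (le_max_right _ _)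

/-- The bound is reached by giving the capacity at each point to the types of largest margin, where
that margin is positive, with ties split equally. -/
theorem exists_attainable_eq_surplus (hg : ∀ k, AEMeasurable (g k) P)
    (hg0 : ∀ k, ∀ᵐ ω ∂P, 0 ≤ g k ω) (hc : Integrable c P) (hc0 : ∀ᵐ ω ∂P, 0 ≤ c ω)
    (p : κ → ℝ) :
    ∃ z ∈ attainable P g c, ∑ k, p k * z.1 k - z.2 = ∫ ω, surplus g c p ω ∂P := by
  classical
  let M : Ω → ℝ := fun ω => max (⨆ k, (p k - g k ω)) 0
  have hM : AEMeasurable M P := aemeasurable_max_iSup hg p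
  let S : κ → Set Ω := fun k => {ω | M ω = p k - g k ω} ∩ {ω | 0 < M ω}
  have hS : ∀ k, NullMeasurableSet (S k) P := fun k =>
    (nullMeasurableSet_eq_fun hM ((hg k).const_sub (p k))).inter
      (nullMeasurableSet_lt aemeasurable_const hM)
  let w : κ → Ω → ℝ := fun k => (S k).indicator fun _ => 1
  have hw : ∀ k, AEMeasurable (w k) P := fun k => aemeasurable_const.indicator₀ (hS k)
  have hw0 : ∀ k ω, 0 ≤ w k ω := fun k ω => Set.indicator_nonneg (fun _ _ => zero_le_one) ω
  -- `N` counts the optimal types. Where it vanishes, `w k ω / N ω` is `0 / 0 = 0` and nothing is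
  -- served.
  let N : Ω → ℝ := fun ω => ∑ k, w k ω
  have hN : AEMeasurable N P := Finset.aemeasurable_fun_sum _ fun k _ => hw k
  have hN0 : ∀ ω, 0 ≤ N ω := fun ω => Finset.sum_nonneg fun k _ => hw0 k ω
  have hwN : ∀ k ω, w k ω / N ω ≤ 1 := fun k ω => div_le_one_of_le₀
    (Finset.single_le_sum (f := fun k => w k ω) (fun k _ => hw0 k ω) (Finset.mem_univ k)) (hN0 ω)
  have hwN0 : ∀ k ω, 0 ≤ w k ω / N ω := fun k ω => div_nonneg (hw0 k ω) (hN0 ω)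
  have hwNm : ∀ k, AEMeasurable (fun ω => w k ω / N ω) P := fun k => (hw k).div hN
  have hν : ∀ k, Integrable (fun ω => w k ω / N ω * c ω) P := fun k =>
    hc.bdd_mul (c := 1) (hwNm k).aestronglyMeasurable
      (Filter.Eventually.of_forall fun ω => by
        rw [Real.norm_of_nonneg (hwN0 k ω)]; exact hwN k ω)
  have hgw : ∀ k, Integrable (fun ω => g k ω * (w k ω / N ω * c ω)) P := fun k => by
    have : Integrable (fun ω => (g k ω * (w k ω / N ω)) * c ω) P := by
      refine hc.bdd_mul (c := |p k|) ((hg k).mul (hwNm k)).aestronglyMeasurable ?_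
      filter_upwards [hg0 k] with ω h0
      rw [Real.norm_of_nonneg (mul_nonneg h0 (hwN0 k ω))]
      by_cases hω : ω ∈ S k
      -- A served type has positive margin, so its cost is below `p k`; this makes the cost of the
      -- plan integrable.
      · have h1 : M ω = p k - g k ω := hω.1
        have h2 : 0 < M ω := hω.2
        exact (mul_le_of_le_one_right h0 (hwN k ω)).trans (by linarith [le_abs_self (p k)])
      · simp [w, Set.indicator_of_notMem hω]
    simpa only [mul_assoc] using this
  refine ⟨(fun k => ∫ ω, w k ω / N ω * c ω ∂P, ∑ k, ∫ ω, g k ω * (w k ω / N ω * c ω) ∂P),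
    ⟨fun k ω => w k ω / N ω * c ω, hν, fun k => ?_, ?_, fun k => rfl, hgw, rfl⟩, ?_⟩
  · filter_upwards [hc0] with ω h
    exact mul_nonneg (hwN0 k ω) h
  · filter_upwards [hc0] with ω h
    rw [← Finset.sum_mul, ← Finset.sum_div]
    exact mul_le_of_le_one_left h (div_self_le_one _)
  · have hterm : ∀ k, Integrable
        (fun ω => p k * (w k ω / N ω * c ω) - g k ω * (w k ω / N ω * c ω)) P :=
      fun k => ((hν k).const_mul (p k)).sub (hgw k)
    have : ∑ k, p k * (∫ ω, w k ω / N ω * c ω ∂P) - ∑ k, ∫ ω, g k ω * (w k ω / N ω * c ω) ∂P =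
        ∫ ω, ∑ k, (p k * (w k ω / N ω * c ω) - g k ω * (w k ω / N ω * c ω)) ∂P := by
      rw [integral_finsetSum _ fun k _ => hterm k, ← Finset.sum_sub_distrib]
      refine Finset.sum_congr rfl fun k _ => ?_
      rw [integral_sub ((hν k).const_mul (p k)) (hgw k), integral_const_mul]
    rw [this]
    refine integral_congr_ae (Filter.Eventually.of_forall fun ω => ?_)
    have hk : ∀ k, p k * (w k ω / N ω * c ω) - g k ω * (w k ω / N ω * c ω) =
        M ω * c ω * (w k ω / N ω) := fun k => by
      by_cases hω : ω ∈ S k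
      · have h1 : M ω = p k - g k ω := hω.1
        rw [h1]; ring
      · simp [w, Set.indicator_of_notMem hω]
    change ∑ k, (p k * (w k ω / N ω * c ω) - g k ω * (w k ω / N ω * c ω)) = M ω * c ω
    simp_rw [hk]
    rw [← Finset.mul_sum, ← Finset.sum_div]
    change M ω * c ω * (N ω / N ω) = M ω * c ω
    have hM0 : 0 ≤ M ω := le_max_right _ _
    rcases hM0.eq_or_lt with h0 | hpos
    · rw [← h0, zero_mul, zero_mul]
    · obtain ⟨k, hk⟩ := exists_eq_of_max_iSup_pos hpos
      have hmem : ω ∈ S k := ⟨hk, hpos⟩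
      have h1 : w k ω = 1 := Set.indicator_of_mem hmem _
      have h2 : w k ω ≤ N ω := Finset.single_le_sum (f := fun k => w k ω)
        (fun k _ => hw0 k ω) (Finset.mem_univ k)
      rw [div_self (by linarith), mul_one]

theorem convex_attainable : Convex ℝ (attainable P g c) := by
  rintro z ⟨ν, hi, h0, hle, hm, hgi, hs⟩ z' ⟨ν', hi', h0', hle', hm', hgi', hs'⟩ a b ha hb hab
  have heq : ∀ k ω, g k ω * (a * ν k ω + b * ν' k ω) =
      a * (g k ω * ν k ω) + b * (g k ω * ν' k ω) := fun k ω => by ring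
  refine ⟨fun k ω => a * ν k ω + b * ν' k ω,
    fun k => ((hi k).const_mul a).add ((hi' k).const_mul b), fun k => ?_, ?_, fun k => ?_,
    fun k => ?_, ?_⟩
  · filter_upwards [h0 k, h0' k] with ω h h'
    positivity
  · filter_upwards [hle, hle'] with ω h h'
    rw [Finset.sum_add_distrib, ← Finset.mul_sum, ← Finset.mul_sum]
    calc _ ≤ a * c ω + b * c ω := by gcongr
      _ = c ω := by rw [← add_mul, hab, one_mul]
  · rw [integral_add ((hi k).const_mul a) ((hi' k).const_mul b), integral_const_mul,
      integral_const_mul, hm, hm']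
    rfl
  · simp_rw [heq]
    exact ((hgi k).const_mul a).add ((hgi' k).const_mul b)
  · simp_rw [heq]
    have : ∀ k, ∫ ω, a * (g k ω * ν k ω) + b * (g k ω * ν' k ω) ∂P =
        a * (∫ ω, g k ω * ν k ω ∂P) + b * ∫ ω, g k ω * ν' k ω ∂P := fun k => by
      rw [integral_add ((hgi k).const_mul a) ((hgi' k).const_mul b), integral_const_mul,
        integral_const_mul]
    simp_rw [this]
    rw [Finset.sum_add_distrib, ← Finset.mul_sum, ← Finset.mul_sum, hs, hs']
    rfl

/-- Each component of the plan is scaled by `b k / z.1 k ≤ 1`, which cannot raise a nonnegative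
cost. -/
theorem exists_attainable_of_le (hg0 : ∀ k, ∀ᵐ ω ∂P, 0 ≤ g k ω) {z : (κ → ℝ) × ℝ}
    (hz : z ∈ attainable P g c) {b : κ → ℝ} (hb0 : ∀ k, 0 ≤ b k) (hb : ∀ k, b k ≤ z.1 k) :
    ∃ s ≤ z.2, (b, s) ∈ attainable P g c := by
  obtain ⟨ν, hi, h0, hle, hm, hgi, hs⟩ := hz
  have ht0 : ∀ k, 0 ≤ b k / z.1 k := fun k => div_nonneg (hb0 k) ((hb0 k).trans (hb k))
  have ht1 : ∀ k, b k / z.1 k ≤ 1 := fun k => div_le_one_of_le₀ (hb k) ((hb0 k).trans (hb k))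
  have heq : ∀ k ω, g k ω * (b k / z.1 k * ν k ω) = b k / z.1 k * (g k ω * ν k ω) :=
    fun k ω => by ring
  refine ⟨∑ k, ∫ ω, g k ω * (b k / z.1 k * ν k ω) ∂P, ?_,
    fun k ω => b k / z.1 k * ν k ω, fun k => (hi k).const_mul _, fun k => ?_, ?_, fun k => ?_,
    fun k => ?_, rfl⟩
  · rw [← hs]
    refine Finset.sum_le_sum fun k _ => ?_
    simp_rw [heq]
    rw [integral_const_mul]
    refine mul_le_of_le_one_left (integral_nonneg_of_ae ?_) (ht1 k)
    filter_upwards [hg0 k, h0 k] with ω h h'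
    exact mul_nonneg h h'
  · filter_upwards [h0 k] with ω h
    exact mul_nonneg (ht0 k) h
  · filter_upwards [hle, ae_all_iff.2 h0] with ω h h'
    exact (Finset.sum_le_sum fun k _ => mul_le_of_le_one_left (h' k) (ht1 k)).trans h
  · rw [integral_const_mul, hm]
    -- If `z.1 k = 0`, the ratio is `0` by convention, and `b k = 0` as well.
    rcases eq_or_ne (z.1 k) 0 with h | h
    · have := le_antisymm ((hb k).trans h.le) (hb0 k)
      simp [this]
    · exact div_mul_cancel₀ _ h
  · simp_rw [heq]
    exact (hgi k).const_mul _

end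

/-- Minimax with one compact side, for a continuous convex-concave function. -/
theorem exists_forall_lt_of_forall_exists_lt {E F : Type*}
    [TopologicalSpace E] [AddCommGroup E] [Module ℝ E] [IsTopologicalAddGroup E]
    [ContinuousSMul ℝ E] [TopologicalSpace F] [AddCommGroup F] [Module ℝ F]
    [IsTopologicalAddGroup F] [ContinuousSMul ℝ F] {K : Set E} {A : Set F} {f : E → F → ℝ}
    (hKn : K.Nonempty) (hK : IsCompact K) (hKc : Convex ℝ K) (hA : Convex ℝ A)
    (hf₁ : ∀ y, Continuous fun x => f x y) (hf₂ : ∀ x, Continuous (f x))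
    (hc₁ : ∀ y, ConvexOn ℝ K fun x => f x y) (hc₂ : ∀ x, ConcaveOn ℝ A (f x)) {t : ℝ}
    (h : ∀ x ∈ K, ∃ y ∈ A, t < f x y) : ∃ y ∈ A, ∀ x ∈ K, t < f x y := by
  -- Compactness of `K` leaves finitely many `y` to beat `t` everywhere on `K`; the finite form of
  -- Sion's theorem merges them into one point of the convex set `A`.
  obtain ⟨s, hs⟩ := hK.elim_finite_subcover (fun y : A => {x | t < f x y})
    (fun y => isOpen_lt continuous_const (hf₁ y)) fun x hx => by
      obtain ⟨y, hy, hlt⟩ := h x hx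
      exact Set.mem_iUnion.2 ⟨⟨y, hy⟩, hlt⟩
  refine Sion.exists_lt_iInf_of_lt_iInf_of_finite hKn hK
    (fun y _ => (hf₁ y).lowerSemicontinuous.lowerSemicontinuousOn _)
    (fun y _ => (hc₁ y).quasiconvexOn) hA
    (fun x _ => (hf₂ x).upperSemicontinuous.upperSemicontinuousOn _)
    (fun x _ => (hc₂ x).quasiconcaveOn) hKc
    (s := Subtype.val '' (s : Set A)) (s.finite_toSet.image _) ?_ fun x hx => ?_
  · rintro _ ⟨y, -, rfl⟩
    exact y.2
  · obtain ⟨y, hy, hlt⟩ := Set.mem_iUnion₂.1 (hs hx)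
    exact ⟨y, ⟨y, hy, rfl⟩, hlt⟩

/-! ### Extended-valued transport costs and attainable pairs -/

section

variable {n m d : ℕ}

theorem sum_lintegral_ofReal_eq {Ω ι κ : Type*} [MeasurableSpace Ω] [Fintype ι] [Fintype κ]
    {P : Measure Ω} {f : ι → κ → Ω → ℝ} (hf : ∀ i k, Integrable (f i k) P)
    (hf0 : ∀ i k, ∀ᵐ ω ∂P, 0 ≤ f i k ω) :
    ∑ i, ∑ k, ∫⁻ ω, ENNReal.ofReal (f i k ω) ∂P =
      ENNReal.ofReal (∑ i, ∑ k, ∫ ω, f i k ω ∂P) := by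
  have h0 : ∀ i k, 0 ≤ ∫ ω, f i k ω ∂P := fun i k => integral_nonneg_of_ae (hf0 i k)
  rw [ENNReal.ofReal_sum_of_nonneg fun i _ => Finset.sum_nonneg fun k _ => h0 i k]
  refine Finset.sum_congr rfl fun i _ => ?_
  rw [ENNReal.ofReal_sum_of_nonneg fun k _ => h0 i k]
  exact Finset.sum_congr rfl fun k _ => (ofReal_integral_eq_lintegral_ofReal (hf i k) (hf0 i k)).symm

theorem integrable_of_sum_lintegral_ne_top {Ω ι κ : Type*} [MeasurableSpace Ω] [Fintype ι]
    [Fintype κ] {P : Measure Ω} {f : ι → κ → Ω → ℝ} (hf : ∀ i k, AEMeasurable (f i k) P)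
    (hf0 : ∀ i k, ∀ᵐ ω ∂P, 0 ≤ f i k ω)
    (h : ∑ i, ∑ k, ∫⁻ ω, ENNReal.ofReal (f i k ω) ∂P ≠ ⊤) (i : ι) (k : κ) :
    Integrable (f i k) P := by
  refine ⟨(hf i k).aestronglyMeasurable, ?_⟩
  rw [hasFiniteIntegral_iff_ofReal (hf0 i k)]
  have h1 := (ENNReal.sum_lt_top.1 h.lt_top) i (Finset.mem_univ i)
  exact (ENNReal.sum_lt_top.1 h1) k (Finset.mem_univ k)

theorem otTime_le {T : Set ℝ} {ℓ : Fin m → ℝ → ℝ} {c : Fin n → ℝ → ℝ} {q : Fin n → Fin m → ℝ}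
    (hℓ0 : ∀ j, ∀ᵐ t ∂(volume.restrict T), 0 ≤ ℓ j t) {s : Fin n → ℝ}
    (h : ∀ i, (q i, s i) ∈ attainable (volume.restrict T) ℓ (c i)) :
    otTime T ℓ c q ≤ ENNReal.ofReal (∑ i, s i) := by
  choose ν hi h0 hle hm hgi hs using h
  refine (iInf₂_le ν ⟨fun i j => ⟨hi i j, h0 i j⟩, hle, hm⟩).trans_eq ?_
  rw [sum_lintegral_ofReal_eq hgi]
  · simp only [hs]
  · intro i j
    filter_upwards [hℓ0 j, h0 i j] with t h1 h2
    exact mul_nonneg h1 h2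

/-- A plan of infinite cost satisfies any lower bound; finite cost makes every product integrable,
so the plan splits into attainable pairs, one per station. -/
theorem ofReal_le_otTime {T : Set ℝ} {ℓ : Fin m → ℝ → ℝ} {c : Fin n → ℝ → ℝ}
    {q : Fin n → Fin m → ℝ} (hℓ : ∀ j, AEMeasurable (ℓ j) (volume.restrict T))
    (hℓ0 : ∀ j, ∀ᵐ t ∂(volume.restrict T), 0 ≤ ℓ j t) {b : ℝ}
    (h : ∀ s : Fin n → ℝ, (∀ i, (q i, s i) ∈ attainable (volume.restrict T) ℓ (c i)) →
      b ≤ ∑ i, s i) :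
    ENNReal.ofReal b ≤ otTime T ℓ c q := by
  refine le_iInf₂ fun ν hν => ?_
  obtain ⟨hd, hle, hm⟩ := hν
  have h0 : ∀ i j, ∀ᵐ t ∂(volume.restrict T), 0 ≤ ℓ j t * ν i j t := fun i j => by
    filter_upwards [hℓ0 j, (hd i j).2] with t h1 h2
    exact mul_nonneg h1 h2
  by_cases htop : ∑ i, ∑ j, ∫⁻ t in T, ENNReal.ofReal (ℓ j t * ν i j t) = ⊤
  · rw [htop]; exact le_top
  · have hint := integrable_of_sum_lintegral_ne_top (f := fun i j t => ℓ j t * ν i j t)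
      (fun i j => (hℓ j).mul (hd i j).1.aemeasurable) h0 htop
    rw [sum_lintegral_ofReal_eq hint h0]
    refine ENNReal.ofReal_le_ofReal (h _ fun i => ?_)
    exact ⟨ν i, fun j => (hd i j).1, fun j => (hd i j).2, hle i, hm i, hint i, rfl⟩

theorem otSpace_le {X : Set (Space d)} {δhat : ℝ → ℝ} {y : Fin n → Space d}
    {μ : Fin m → Space d → ℝ} {q : Fin n → Fin m → ℝ}
    (hδ0 : ∀ i, ∀ᵐ x ∂(volume.restrict X), 0 ≤ spatialCost δhat x (y i)) {s : Fin m → ℝ}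
    (h : ∀ j, (fun i => q i j, s j) ∈
      attainable (volume.restrict X) (fun i x => spatialCost δhat x (y i)) (μ j)) :
    otSpace X δhat y μ q ≤ ENNReal.ofReal (∑ j, s j) := by
  choose θ hi h0 hle hm hgi hs using h
  refine (iInf₂_le (fun i j => θ j i)
    ⟨fun i j => ⟨hi j i, h0 j i⟩, hle, fun i j => hm j i⟩).trans_eq ?_
  rw [Finset.sum_comm, sum_lintegral_ofReal_eq hgi]
  · simp only [hs]
  · intro j i
    filter_upwards [hδ0 i, h0 j i] with t h1 h2
    exact mul_nonneg h1 h2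

theorem ofReal_le_otSpace {X : Set (Space d)} {δhat : ℝ → ℝ} {y : Fin n → Space d}
    {μ : Fin m → Space d → ℝ} {q : Fin n → Fin m → ℝ}
    (hδ : ∀ i, AEMeasurable (fun x => spatialCost δhat x (y i)) (volume.restrict X))
    (hδ0 : ∀ i, ∀ᵐ x ∂(volume.restrict X), 0 ≤ spatialCost δhat x (y i)) {b : ℝ}
    (h : ∀ s : Fin m → ℝ, (∀ j, (fun i => q i j, s j) ∈
      attainable (volume.restrict X) (fun i x => spatialCost δhat x (y i)) (μ j)) →
      b ≤ ∑ j, s j) :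
    ENNReal.ofReal b ≤ otSpace X δhat y μ q := by
  refine le_iInf₂ fun θ hθ => ?_
  obtain ⟨hd, hle, hm⟩ := hθ
  have h0 : ∀ j i, ∀ᵐ x ∂(volume.restrict X), 0 ≤ spatialCost δhat x (y i) * θ i j x :=
    fun j i => by
      filter_upwards [hδ0 i, (hd i j).2] with t h1 h2
      exact mul_nonneg h1 h2
  rw [Finset.sum_comm]
  by_cases htop :
      ∑ j, ∑ i, ∫⁻ x in X, ENNReal.ofReal (spatialCost δhat x (y i) * θ i j x) = ⊤
  · rw [htop]; exact le_top
  · have hint := integrable_of_sum_lintegral_ne_top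
      (f := fun j i x => spatialCost δhat x (y i) * θ i j x)
      (fun j i => (hδ i).mul (hd i j).1.aemeasurable) h0 htop
    rw [sum_lintegral_ofReal_eq hint h0]
    refine ENNReal.ofReal_le_ofReal (h _ fun j => ?_)
    exact ⟨fun i => θ i j, fun i => (hd i j).1, fun i => (hd i j).2, hle j, fun i => hm i j,
      hint j, rfl⟩

/-! ### Weak duality -/

/-- Every dual variable gives an upper bound on the barycenter problem. -/
theorem stbObjective_le_stbDObjective {X : Set (Space d)} {T : Set ℝ} {r : ℝ} {δhat : ℝ → ℝ}
    {y : Fin n → Space d} {ℓ : Fin m → ℝ → ℝ} {c : Fin n → ℝ → ℝ} {μ : Fin m → Space d → ℝ}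
    (hℓ : ∀ j, AEMeasurable (ℓ j) (volume.restrict T))
    (hℓ0 : ∀ j, ∀ᵐ t ∂(volume.restrict T), 0 ≤ ℓ j t)
    (hδ : ∀ i, AEMeasurable (fun x => spatialCost δhat x (y i)) (volume.restrict X))
    (hδ0 : ∀ i, ∀ᵐ x ∂(volume.restrict X), 0 ≤ spatialCost δhat x (y i))
    (hc : ∀ i, IntegrableOn (c i) T) (hμ : ∀ j, IntegrableOn (μ j) X)
    (q η : Fin n → Fin m → ℝ) :
    stbObjective X T r δhat y ℓ c μ q ≤ (stbDObjective X T r δhat y ℓ c μ η : EReal) := by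
  set a : ℝ := ∑ i, (∑ j, η i j * q i j - ∫ t in T, timeIntegrand ℓ c η i t) with ha
  set b : ℝ := ∑ j, (∑ i, (r - η i j) * q i j - ∫ x in X, spaceIntegrand r δhat y μ η j x) with hb
  have h1 : ENNReal.ofReal a ≤ otTime T ℓ c q := by
    refine ofReal_le_otTime hℓ hℓ0 fun s hs => Finset.sum_le_sum fun i _ => ?_
    have h : ∑ j, η i j * q i j - s i ≤ ∫ t in T, timeIntegrand ℓ c η i t :=
      attainable_le_surplus hℓ hℓ0 (hc i) (hs i) (η i)
    linarith
  have h2 : ENNReal.ofReal b ≤ otSpace X δhat y μ q := by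
    refine ofReal_le_otSpace hδ hδ0 fun s hs => Finset.sum_le_sum fun j _ => ?_
    have h : ∑ i, (r - η i j) * q i j - s j ≤ ∫ x in X, spaceIntegrand r δhat y μ η j x :=
      attainable_le_surplus hδ hδ0 (hμ j) (hs j) fun i => r - η i j
    linarith
  -- `a` or `b` may be negative; truncation by `ENNReal.ofReal` only increases them.
  have coe_le : ∀ {x : ℝ} {z : ENNReal}, ENNReal.ofReal x ≤ z → (x : EReal) ≤ (z : EReal) :=
    fun {x z} h => by
      refine le_trans ?_ (EReal.coe_ennreal_le_coe_ennreal_iff.2 h)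
      rw [EReal.coe_ennreal_ofReal]
      exact EReal.coe_le_coe_iff.2 (le_max_left _ _)
  have h3 : ∑ i, ∑ j, r * q i j - a - b = stbDObjective X T r δhat y ℓ c μ η := by
    rw [ha, hb, stbDObjective, Finset.sum_sub_distrib, Finset.sum_sub_distrib,
      Finset.sum_comm (γ := Fin m) (f := fun j i => (r - η i j) * q i j)]
    have : ∑ i, ∑ j, r * q i j = ∑ i, ∑ j, η i j * q i j + ∑ i, ∑ j, (r - η i j) * q i j := by
      simp_rw [← Finset.sum_add_distrib]
      exact Finset.sum_congr rfl fun i _ => Finset.sum_congr rfl fun j _ => by ring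
    linarith
  rw [← h3, EReal.coe_sub, EReal.coe_sub]
  exact EReal.sub_le_sub (EReal.sub_le_sub le_rfl (coe_le h1)) (coe_le h2)

/-! ### Strong duality -/

/-- Separate plans of the two stages can be trimmed to a common intermediate measure. -/
theorem le_stbValue_of_attainable {X : Set (Space d)} {T : Set ℝ} {r : ℝ} {δhat : ℝ → ℝ}
    {y : Fin n → Space d} {ℓ : Fin m → ℝ → ℝ} {c : Fin n → ℝ → ℝ} {μ : Fin m → Space d → ℝ}
    (hℓ0 : ∀ j, ∀ᵐ t ∂(volume.restrict T), 0 ≤ ℓ j t)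
    (hδ0 : ∀ i, ∀ᵐ x ∂(volume.restrict X), 0 ≤ spatialCost δhat x (y i))
    (hc : ∀ i, IntegrableOn (c i) T) (hμ : ∀ j, IntegrableOn (μ j) X)
    {u : Fin n → (Fin m → ℝ) × ℝ} {v : Fin m → (Fin n → ℝ) × ℝ}
    (hu : ∀ i, u i ∈ attainable (volume.restrict T) ℓ (c i))
    (hv : ∀ j, v j ∈
      attainable (volume.restrict X) (fun i x => spatialCost δhat x (y i)) (μ j)) :
    ((∑ i, ∑ j, r * min ((u i).1 j) ((v j).1 i) - ∑ i, (u i).2 - ∑ j, (v j).2 : ℝ) : EReal) ≤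
      stbValue X T r δhat y ℓ c μ := by
  set q : Fin n → Fin m → ℝ := fun i j => min ((u i).1 j) ((v j).1 i)
  have hq0 : ∀ i j, 0 ≤ q i j := fun i j =>
    le_min (attainable_nonneg (hu i) j) (attainable_nonneg (hv j) i)
  have hs : ∀ i, ∃ s ≤ (u i).2, (q i, s) ∈ attainable (volume.restrict T) ℓ (c i) := fun i =>
    exists_attainable_of_le hℓ0 (hu i) (hq0 i) fun j => min_le_left _ _
  have hs' : ∀ j, ∃ s ≤ (v j).2, (fun i => q i j, s) ∈
      attainable (volume.restrict X) (fun i x => spatialCost δhat x (y i)) (μ j) := fun j =>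
    exists_attainable_of_le hδ0 (hv j) (fun i => hq0 i j) fun i => min_le_right _ _
  choose s hsu hs using hs
  choose s' hsv hs' using hs'
  have hfeas : StbFeasible X T c μ q := ⟨hq0, fun j => attainable_sum_le (hμ j) (hs' j),
    fun i => attainable_sum_le (hc i) (hs i)⟩
  have cost_nonneg : ∀ {Ω : Type} {κ : Type} [MeasurableSpace Ω] [Fintype κ] {P : Measure Ω}
      {g : κ → Ω → ℝ} {f : Ω → ℝ} {z : (κ → ℝ) × ℝ}, (∀ k, ∀ᵐ ω ∂P, 0 ≤ g k ω) →
      z ∈ attainable P g f → 0 ≤ z.2 := by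
    rintro Ω κ _ _ P g f z hg ⟨ν, -, h0, -, -, -, hz⟩
    rw [← hz]
    refine Finset.sum_nonneg fun k _ => integral_nonneg_of_ae ?_
    filter_upwards [hg k, h0 k] with ω h1 h2
    exact mul_nonneg h1 h2
  have coe_le : ∀ {x x' : ℝ} {z : ENNReal}, 0 ≤ x → x ≤ x' → z ≤ ENNReal.ofReal x →
      (z : EReal) ≤ (x' : EReal) := fun {x x' z} h0 hx h => by
    refine (EReal.coe_ennreal_le_coe_ennreal_iff.2 h).trans ?_
    rw [EReal.coe_ennreal_ofReal, max_eq_left h0]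
    exact EReal.coe_le_coe_iff.2 hx
  refine le_trans ?_ (le_iSup₂ (f := fun q (_ : StbFeasible X T c μ q) =>
    stbObjective X T r δhat y ℓ c μ q) q hfeas)
  rw [EReal.coe_sub, EReal.coe_sub]
  exact EReal.sub_le_sub (EReal.sub_le_sub le_rfl
    (coe_le (Finset.sum_nonneg fun i _ => cost_nonneg hℓ0 (hs i))
      (Finset.sum_le_sum fun i _ => hsu i) (otTime_le hℓ0 hs)))
    (coe_le (Finset.sum_nonneg fun j _ => cost_nonneg hδ0 (hs' j))
      (Finset.sum_le_sum fun j _ => hsv j) (otSpace_le hδ0 hs'))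

/-- Value of a pair of plans at the prices `η` and `r - η` of the two stages. -/
noncomputable def lagrangian (r : ℝ) (η : Fin n → Fin m → ℝ)
    (z : (Fin n → (Fin m → ℝ) × ℝ) × (Fin m → (Fin n → ℝ) × ℝ)) : ℝ :=
  ∑ i, (∑ j, η i j * (z.1 i).1 j - (z.1 i).2) + ∑ j, (∑ i, (r - η i j) * (z.2 j).1 i - (z.2 j).2)

/-- The weights must sum to one because the costs and the constant `r` do not scale with `η`. -/
theorem lagrangian_affine_left (r : ℝ) (η η' : Fin n → Fin m → ℝ)
    (z : (Fin n → (Fin m → ℝ) × ℝ) × (Fin m → (Fin n → ℝ) × ℝ)) {a b : ℝ} (hab : a + b = 1) :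
    lagrangian r (a • η + b • η') z = a * lagrangian r η z + b * lagrangian r η' z := by
  obtain rfl : b = 1 - a := by linarith
  simp only [lagrangian, mul_add, Finset.mul_sum, mul_sub]
  rw [add_add_add_comm]
  simp only [← Finset.sum_add_distrib]
  congr 1
  all_goals
    refine Finset.sum_congr rfl fun i _ => ?_
    rw [sub_add_sub_comm, ← Finset.sum_add_distrib]
    congr 1
    · refine Finset.sum_congr rfl fun j _ => ?_
      simp only [Pi.add_apply, Pi.smul_apply, smul_eq_mul]
      ring
    · ring

theorem lagrangian_affine_right (r : ℝ) (η : Fin n → Fin m → ℝ)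
    (z z' : (Fin n → (Fin m → ℝ) × ℝ) × (Fin m → (Fin n → ℝ) × ℝ)) (a b : ℝ) :
    lagrangian r η (a • z + b • z') = a * lagrangian r η z + b * lagrangian r η z' := by
  simp only [lagrangian, mul_add, Finset.mul_sum, mul_sub]
  rw [add_add_add_comm]
  simp only [← Finset.sum_add_distrib]
  congr 1
  all_goals
    refine Finset.sum_congr rfl fun i _ => ?_
    rw [sub_add_sub_comm, ← Finset.sum_add_distrib]
    congr 1
    refine Finset.sum_congr rfl fun j _ => ?_
    simp only [Prod.fst_add, Prod.snd_add, Prod.smul_fst, Prod.smul_snd, Pi.add_apply,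
      Pi.smul_apply, smul_eq_mul]
    ring

theorem iInf_stbDObjective_le_stbValue {X : Set (Space d)} {T : Set ℝ} {r : ℝ} (hr : 0 ≤ r)
    {δhat : ℝ → ℝ} {y : Fin n → Space d} {ℓ : Fin m → ℝ → ℝ} {c : Fin n → ℝ → ℝ}
    {μ : Fin m → Space d → ℝ}
    (hℓ : ∀ j, AEMeasurable (ℓ j) (volume.restrict T))
    (hℓ0 : ∀ j, ∀ᵐ t ∂(volume.restrict T), 0 ≤ ℓ j t)
    (hδ : ∀ i, AEMeasurable (fun x => spatialCost δhat x (y i)) (volume.restrict X))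
    (hδ0 : ∀ i, ∀ᵐ x ∂(volume.restrict X), 0 ≤ spatialCost δhat x (y i))
    (hc : ∀ i, IntegrableOn (c i) T) (hμ : ∀ j, IntegrableOn (μ j) X)
    (hc0 : ∀ i, ∀ᵐ t ∂(volume.restrict T), 0 ≤ c i t)
    (hμ0 : ∀ j, ∀ᵐ x ∂(volume.restrict X), 0 ≤ μ j x) :
    (⨅ η : Fin n → Fin m → ℝ, (stbDObjective X T r δhat y ℓ c μ η : EReal)) ≤
      stbValue X T r δhat y ℓ c μ := by
  by_contra! hlt
  obtain ⟨t, ht1, ht2⟩ := EReal.lt_iff_exists_real_btwn.1 hlt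
  set A : Set ((Fin n → (Fin m → ℝ) × ℝ) × (Fin m → (Fin n → ℝ) × ℝ)) :=
    (Set.univ.pi fun i => attainable (volume.restrict T) ℓ (c i)) ×ˢ
      (Set.univ.pi fun j =>
        attainable (volume.restrict X) (fun i x => spatialCost δhat x (y i)) (μ j)) with hAdef
  have hA : Convex ℝ A :=
    (convex_pi fun i _ => convex_attainable).prod (convex_pi fun j _ => convex_attainable)
  have hK : Convex ℝ (Set.Icc (0 : Fin n → Fin m → ℝ) fun _ _ => r) := convex_Icc _ _
  -- For fixed `η`, optimal plans in each subproblem give the Lagrangian the value of the dual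
  -- objective, which exceeds `t`.
  obtain ⟨z, hz, hmin⟩ := exists_forall_lt_of_forall_exists_lt (f := lagrangian r) (t := t)
    (K := Set.Icc (0 : Fin n → Fin m → ℝ) fun _ _ => r)
    ⟨0, le_rfl, fun _ _ => hr⟩ isCompact_Icc hK hA
    (fun z => by unfold lagrangian; fun_prop) (fun η => by unfold lagrangian; fun_prop)
    (fun z => ⟨hK, fun η _ η' _ a b _ _ hab => (lagrangian_affine_left r η η' z hab).le⟩)
    (fun η => ⟨hA, fun z _ z' _ a b _ _ _ => (lagrangian_affine_right r η z z' a b).ge⟩)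
    (fun η _ => by
      choose u hu hue using fun i => exists_attainable_eq_surplus hℓ hℓ0 (hc i) (hc0 i) (η i)
      choose v hv hve using fun j =>
        exists_attainable_eq_surplus hδ hδ0 (hμ j) (hμ0 j) fun i => r - η i j
      refine ⟨(u, v), ⟨fun i _ => hu i, fun j _ => hv j⟩, ?_⟩
      have h := EReal.coe_lt_coe_iff.1 (ht2.trans_le (iInf_le _ η))
      simp only [lagrangian, hue, hve]
      exact h)
  have h1 := le_stbValue_of_attainable (r := r) hℓ0 hδ0 hc hμ (fun i => hz.1 i trivial)
    (fun j => hz.2 j trivial)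
  -- The coefficient of `η i j` is the temporal mass minus the spatial mass, so its sign selects the
  -- endpoint `r` or `0` that minimises the Lagrangian and produces `r * min`.
  have h2 := hmin (fun i j => if (z.1 i).1 j ≤ (z.2 j).1 i then r else 0)
    ⟨fun i j => by dsimp only; split_ifs <;> simp [hr],
      fun i j => by dsimp only; split_ifs <;> simp [hr]⟩
  refine (EReal.coe_lt_coe_iff.2 h2).not_ge (le_trans (le_of_eq ?_) (h1.trans ht1.le))
  congr 1
  rw [lagrangian, Finset.sum_sub_distrib, Finset.sum_sub_distrib,
    Finset.sum_comm (γ := Fin m)]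
  have : ∑ i, ∑ j, r * min ((z.1 i).1 j) ((z.2 j).1 i) =
      ∑ i, ∑ j, (if (z.1 i).1 j ≤ (z.2 j).1 i then r else 0) * (z.1 i).1 j +
      ∑ i, ∑ j, (r - if (z.1 i).1 j ≤ (z.2 j).1 i then r else 0) * (z.2 j).1 i := by
    simp_rw [← Finset.sum_add_distrib]
    refine Finset.sum_congr rfl fun i _ => Finset.sum_congr rfl fun j _ => ?_
    split_ifs with h
    · rw [min_eq_left h]; ring
    · rw [min_eq_right (not_le.1 h).le]; ring
  linarith

/-! ### Convexity of the dual and the final theorem -/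

theorem convexOn_stbDObjective {X : Set (Space d)} {T : Set ℝ} {r : ℝ}
    {δhat : ℝ → ℝ} {y : Fin n → Space d} {ℓ : Fin m → ℝ → ℝ} {c : Fin n → ℝ → ℝ}
    {μ : Fin m → Space d → ℝ}
    (hℓ : ∀ j, AEMeasurable (ℓ j) (volume.restrict T))
    (hℓ0 : ∀ j, ∀ᵐ t ∂(volume.restrict T), 0 ≤ ℓ j t)
    (hδ : ∀ i, AEMeasurable (fun x => spatialCost δhat x (y i)) (volume.restrict X))
    (hδ0 : ∀ i, ∀ᵐ x ∂(volume.restrict X), 0 ≤ spatialCost δhat x (y i))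
    (hc : ∀ i, IntegrableOn (c i) T) (hμ : ∀ j, IntegrableOn (μ j) X)
    (hc0 : ∀ i, ∀ᵐ t ∂(volume.restrict T), 0 ≤ c i t)
    (hμ0 : ∀ j, ∀ᵐ x ∂(volume.restrict X), 0 ≤ μ j x) :
    ConvexOn ℝ Set.univ (stbDObjective X T r δhat y ℓ c μ) := by
  refine ⟨convex_univ, fun η _ η' _ a b ha hb hab => ?_⟩
  have h1 : ∀ i, ∫ t in T, timeIntegrand ℓ c (a • η + b • η') i t ≤
      a * (∫ t in T, timeIntegrand ℓ c η i t) + b * ∫ t in T, timeIntegrand ℓ c η' i t :=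
    fun i => (convexOn_integral_surplus hℓ hℓ0 (hc i) (hc0 i)).2 (Set.mem_univ (η i))
      (Set.mem_univ (η' i)) ha hb hab
  have h2 : ∀ j, ∫ x in X, spaceIntegrand r δhat y μ (a • η + b • η') j x ≤
      a * (∫ x in X, spaceIntegrand r δhat y μ η j x) +
        b * ∫ x in X, spaceIntegrand r δhat y μ η' j x := fun j => by
    have h := (convexOn_integral_surplus hδ hδ0 (hμ j) (hμ0 j)).2
      (Set.mem_univ fun i => r - η i j) (Set.mem_univ fun i => r - η' i j) ha hb hab
    -- Since `a + b = 1`, the prices `r - η i j` combine with the same weights as `η`.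
    have he : (a • (fun i => r - η i j) + b • fun i => r - η' i j) =
        fun i => r - (a • η + b • η') i j := by
      ext i
      simp only [Pi.add_apply, Pi.smul_apply, smul_eq_mul]
      linear_combination r * hab
    rw [he] at h
    exact h
  have h3 := Finset.sum_le_sum fun i (_ : i ∈ Finset.univ) => h1 i
  have h4 := Finset.sum_le_sum fun j (_ : j ∈ Finset.univ) => h2 j
  rw [Finset.sum_add_distrib, ← Finset.mul_sum, ← Finset.mul_sum] at h3 h4
  simp only [stbDObjective, smul_eq_mul]
  linarith

theorem nonneg_of_deriv_pos {f : ℝ → ℝ} (hf : ContinuousOn f (Set.Ici 0)) (h0 : f 0 = 0)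
    (hpos : ∀ s, 0 < s → 0 < deriv f s) {s : ℝ} (hs : 0 ≤ s) : 0 ≤ f s := by
  have hmono : StrictMonoOn f (Set.Ici 0) :=
    strictMonoOn_of_deriv_pos (convex_Ici 0) hf fun x hx => hpos x (by simpa using hx)
  rw [← h0]
  exact hmono.monotoneOn (Set.mem_Ici.2 le_rfl) hs hs

end

end Matching

theorem mainTheorem2 {n m d : ℕ}
    (X : Set (Matching.Space d)) (hX : IsCompact X)
    (T : Set ℝ) (hT : T.OrdConnected) (hTb : Bornology.IsBounded T)
    (r : ℝ) (hr : 0 < r)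
    (δhat : ℝ → ℝ) (hδc : ContinuousOn δhat (Set.Ici 0))
    (hδd : DifferentiableOn ℝ δhat (Set.Ioi 0)) (hδ0 : δhat 0 = 0)
    (hδpos : ∀ s, 0 < s → 0 < deriv δhat s) (hδconv : ConvexOn ℝ (Set.Ici 0) δhat)
    (y : Fin n → Matching.Space d) (hy : ∀ i, y i ∈ X)
    (ℓ : Fin m → ℝ → ℝ) (hℓc : ∀ j, ContinuousOn (ℓ j) T)
    (hℓ0 : ∀ j, ∀ t ∈ T, 0 ≤ ℓ j t) (hℓi : ∀ j, MeasureTheory.IntegrableOn (ℓ j) T)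
    (c : Fin n → ℝ → ℝ) (hc0 : ∀ i, ∀ t ∈ T, 0 < c i t)
    (hci : ∀ i, MeasureTheory.IntegrableOn (c i) T)
    (μ : Fin m → Matching.Space d → ℝ) (hμ0 : ∀ j, ∀ x ∈ X, 0 ≤ μ j x)
    (hμi : ∀ j, MeasureTheory.IntegrableOn (μ j) X) :
    -- the two problems have the same optimal value
    Matching.stbValue X T r δhat y ℓ c μ =
        (⨅ η : Fin n → Fin m → ℝ,
          ((Matching.stbDObjective X T r δhat y ℓ c μ η : ℝ) : EReal)) ∧
      -- the objective of the second one is everywhere finite, and convex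
      (∀ (η : Fin n → Fin m → ℝ) (i : Fin n),
        MeasureTheory.IntegrableOn (Matching.timeIntegrand ℓ c η i) T) ∧
      (∀ (η : Fin n → Fin m → ℝ) (j : Fin m),
        MeasureTheory.IntegrableOn (Matching.spaceIntegrand r δhat y μ η j) X) ∧
      ConvexOn ℝ Set.univ (Matching.stbDObjective X T r δhat y ℓ c μ) := by
  have hTm : MeasurableSet T := hT.measurableSet
  have hXm : MeasurableSet X := hX.measurableSet
  have hℓ : ∀ j, AEMeasurable (ℓ j) (volume.restrict T) := fun j => (hℓi j).aemeasurable
  have hℓ0' : ∀ j, ∀ᵐ t ∂(volume.restrict T), 0 ≤ ℓ j t := fun j =>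
    ae_restrict_of_forall_mem hTm (hℓ0 j)
  have hc0' : ∀ i, ∀ᵐ t ∂(volume.restrict T), 0 ≤ c i t := fun i =>
    ae_restrict_of_forall_mem hTm fun t ht => (hc0 i t ht).le
  have hμ0' : ∀ j, ∀ᵐ x ∂(volume.restrict X), 0 ≤ μ j x := fun j =>
    ae_restrict_of_forall_mem hXm (hμ0 j)
  have hδ : ∀ i, AEMeasurable (fun x => Matching.spatialCost δhat x (y i))
      (volume.restrict X) := fun i =>
    (hδc.comp_continuous (f := fun x => ‖x - y i‖) (by fun_prop)
      fun x => norm_nonneg (x - y i)).aemeasurable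
  have hδnn : ∀ i, ∀ᵐ x ∂(volume.restrict X), 0 ≤ Matching.spatialCost δhat x (y i) := fun i =>
    Filter.Eventually.of_forall fun x =>
      Matching.nonneg_of_deriv_pos hδc hδ0 hδpos (norm_nonneg _)
  refine ⟨le_antisymm ?_ ?_, fun η i => ?_, fun η j => ?_, ?_⟩
  · exact iSup₂_le fun q _ => le_iInf fun η =>
      Matching.stbObjective_le_stbDObjective hℓ hℓ0' hδ hδnn hci hμi q η
  · exact Matching.iInf_stbDObjective_le_stbValue hr.le hℓ hℓ0' hδ hδnn hci hμi hc0' hμ0'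
  · exact Matching.integrable_surplus hℓ hℓ0' (hci i) (η i)
  · exact Matching.integrable_surplus hδ hδnn (hμi j) fun i => r - η i j
  · exact Matching.convexOn_stbDObjective hℓ hℓ0' hδ hδnn hci hμi hc0' hμ0'
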